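/- Let $k$ be a field with a derivation $\partial$ (possibly trivial, any characteristic), let $\Gamma$ be a totally ordered abelian group, written additively, and let $c:\Gamma\to k$ be an additive map. Let $k((t^\Gamma))$ be the Hahn field of formal series $f=\sum_{\gamma\in\Gamma} f_\gamma t^\gamma$ with coefficients $f_\gamma\in k$ and well-ordered support $\{\gamma: f_\gamma\neq 0\}$, equipped with the derivation $$\partial\Big(\sum_\gamma f_\gamma t^\gamma\Big)=\sum_\gamma\big(\partial(f_\gamma)+f_\gamma c(\gamma)\big)t^\gamma .$$ For $a\in k((t^\Gamma))$ write $a\prec 1$ if every element of the support of $a$ is $>0$; for such $a$ the additive operator $I-a\partial: y\mapsto y-a\,\partial(y)$ on $k((t^\Gamma))$ is bijective, with inverse $(I-a\partial)^{-1}$. A differential subfield of $k((t^\Gamma))$ is a subfield $F$ with $\partial(F)\subseteq F$. A subset $S\subseteq k((t^\Gamma))$ is called truncation closed if $\sum_{\gamma<\gamma_0} f_\gamma t^\gamma\in S$ for all $f\in S$ and all $\gamma_0\in\Gamma$. Let $E$ be a truncation closed differential subfield of $k((t^\Gamma))$, and let $\widehat E$ be the smallest differential subfield of $k((t^\Gamma))$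 that contains $E$ and satisfies $(I-a\partial)^{-1}(f)\in\widehat E$ for all $a,f\in\widehat E$ with $a\prec 1$. Then $\widehat E$ is truncation closed. -/

import Mathlib

namespace HahnDiff

set_option linter.unusedSectionVars false

open scoped HahnSeries Differential Pointwise

variable {k Γ : Type*} [Field k] [Differential k]
  [AddCommGroup Γ] [LinearOrder Γ] [IsOrderedAddMonoid Γ]

/-- The series `∑ (∂ f_γ + f_γ c(γ)) t^γ`, for `f = ∑ f_γ t^γ`. -/
noncomputable def derivFun (c : Γ →+ k) (f : k⟦Γ⟧) : k⟦Γ⟧ where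
  coeff γ := (f.coeff γ)′ + f.coeff γ * c γ
  isPWO_support' := f.isPWO_support.mono fun γ hγ h0 => hγ (by simp [h0])

@[simp]
theorem coeff_derivFun (c : Γ →+ k) (f : k⟦Γ⟧) (γ : Γ) :
    (derivFun c f).coeff γ = (f.coeff γ)′ + f.coeff γ * c γ := rfl

theorem support_derivFun_subset (c : Γ →+ k) (f : k⟦Γ⟧) :
    (derivFun c f).support ⊆ f.support := fun γ hγ h0 => hγ (by simp [h0])

theorem derivFun_mul (c : Γ →+ k) (x y : k⟦Γ⟧) :
    derivFun c (x * y) = x * derivFun c y + y * derivFun c x := by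
  ext g
  rw [mul_comm y, HahnSeries.coeff_add, coeff_derivFun,
    HahnSeries.coeff_mul_right' y.isPWO_support (support_derivFun_subset c y),
    HahnSeries.coeff_mul_left' x.isPWO_support (support_derivFun_subset c x),
    HahnSeries.coeff_mul, map_sum, Finset.sum_mul, ← Finset.sum_add_distrib,
    ← Finset.sum_add_distrib]
  refine Finset.sum_congr rfl fun ij hij => ?_
  have hg : ij.1 + ij.2 = g := (Finset.mem_antidiagonal.1 hij).2.2
  rw [← hg, map_add, Derivation.leibniz]
  simp only [coeff_derivFun, smul_eq_mul]
  ring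

/-- The derivation on the Hahn field `k((t^Γ))` that extends the derivation of `k` and
satisfies `∂(t^γ) = c(γ) t^γ`. -/
noncomputable def deriv (c : Γ →+ k) : Derivation ℤ k⟦Γ⟧ k⟦Γ⟧ :=
  Derivation.mk'
    (AddMonoidHom.toIntLinearMap
      { toFun := derivFun c
        map_zero' := by ext; simp
        map_add' := fun x y => by ext; simp; ring })
    (fun x y => derivFun_mul c x y)

@[simp]
theorem coeff_deriv (c : Γ →+ k) (f : k⟦Γ⟧) (γ : Γ) :
    (deriv c f).coeff γ = (f.coeff γ)′ + f.coeff γ * c γ := rfl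

theorem support_deriv_subset (c : Γ →+ k) (f : k⟦Γ⟧) :
    (deriv c f).support ⊆ f.support := support_derivFun_subset c f

/-- The operator `I - a∂` on `k((t^Γ))`. -/
noncomputable def oneSubOp (c : Γ →+ k) (a : k⟦Γ⟧) : k⟦Γ⟧ →+ k⟦Γ⟧ where
  toFun y := y - a * deriv c y
  map_zero' := by simp
  map_add' x y := by simp only [map_add]; ring

theorem oneSubOp_injective (c : Γ →+ k) {a : k⟦Γ⟧} (ha : 0 < a.orderTop) :
    Function.Injective (oneSubOp c a) := by
  rw [injective_iff_map_eq_zero]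
  intro y hy
  by_contra hy0
  have h : y = a * deriv c y := sub_eq_zero.1 hy
  have h2 : y.coeff y.order ≠ 0 := HahnSeries.coeff_order_eq_zero.not.2 hy0
  rw [h] at h2
  have ha0 : a ≠ 0 := by
    rintro rfl
    exact h2 (by simp)
  obtain ⟨i, hi, j, hj, hij⟩ := HahnSeries.support_mul_subset h2
  have hi' : 0 < i := lt_of_lt_of_le ((HahnSeries.zero_lt_orderTop_iff ha0).1 ha)
    (HahnSeries.order_le_of_coeff_ne_zero hi)
  have hj' : y.order ≤ j :=
    HahnSeries.order_le_of_coeff_ne_zero (support_deriv_subset c y hj)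
  have hij' : i + j = y.order := by rw [← h] at hij; exact hij
  exact absurd hij' (ne_of_gt (lt_of_le_of_lt hj' (lt_add_of_pos_left j hi')))

theorem support_iterate_subset (c : Γ →+ k) (a f : k⟦Γ⟧) (n : ℕ) :
    ((fun y => a * deriv c y)^[n] f).support ⊆
      (AddSubmonoid.closure a.support : Set Γ) + f.support := by
  induction n with
  | zero =>
    intro g hg
    exact ⟨0, AddSubmonoid.zero_mem _, g, hg, zero_add g⟩
  | succ n ih =>
    rw [Function.iterate_succ_apply']
    intro g hg
    obtain ⟨i, hi, j, hj, rfl⟩ := HahnSeries.support_mul_subset hg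
    obtain ⟨p, hp, q, hq, rfl⟩ := ih (support_deriv_subset c _ hj)
    exact ⟨i + p, AddSubmonoid.add_mem _ (AddSubmonoid.subset_closure hi) hp, q, hq,
      add_assoc i p q⟩

/-- The summable family `((a∂)^n f)_n` for `a ≺ 1`. -/
noncomputable def neumannFamily (c : Γ →+ k) (a : k⟦Γ⟧) (ha : 0 < a.orderTop) (f : k⟦Γ⟧) :
    HahnSeries.SummableFamily Γ k ℕ where
  toFun n := (fun y => a * deriv c y)^[n] f
  isPWO_iUnion_support' := by
    refine Set.IsPWO.mono ?_ (Set.iUnion_subset fun n => support_iterate_subset c a f n)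
    exact (a.isPWO_support.addSubmonoid_closure fun g hg => WithTop.coe_le_coe.1
      (ha.le.trans (HahnSeries.orderTop_le_of_coeff_ne_zero hg))).add f.isPWO_support
  finite_co_support' g := by
    have hpos : ∀ i ∈ a.support, 0 < i := fun i hi => WithTop.coe_lt_coe.1
      (ha.trans_le (HahnSeries.orderTop_le_of_coeff_ne_zero hi))
    have hpwo : ((AddSubmonoid.closure a.support : Set Γ) + f.support).IsPWO :=
      (a.isPWO_support.addSubmonoid_closure fun i hi => (hpos i hi).le).add f.isPWO_support
    by_cases hg : g ∈ (AddSubmonoid.closure a.support : Set Γ) + f.support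
    swap
    · exact Set.finite_empty.subset fun n hn => hg (support_iterate_subset c a f n hn)
    apply hpwo.isWF.induction hg
    intro y ys hy
    refine ((((Finset.antidiagonal a.isPWO_support hpwo y).finite_toSet.biUnion
      fun ij hij => hy ij.2 (Finset.mem_antidiagonal.1 (Finset.mem_coe.1 hij)).2.1
        ?_).image Nat.succ).union (Set.finite_singleton 0)).subset ?_
    · obtain ⟨hi, _, hij'⟩ := Finset.mem_antidiagonal.1 (Finset.mem_coe.1 hij)
      rw [← hij']
      exact lt_add_of_pos_left _ (hpos _ hi)
    · rintro (_ | n) hn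
      · exact Set.mem_union_right _ (Set.mem_singleton 0)
      · have hn' : y ∈ ((fun y => a * deriv c y)^[n + 1] f).support := hn
        rw [Function.iterate_succ_apply'] at hn'
        obtain ⟨i, hi, j, hj, rfl⟩ := HahnSeries.support_mul_subset hn'
        have hj' := support_deriv_subset c _ hj
        refine Set.mem_union_left _ ⟨n, Set.mem_iUnion.2 ⟨⟨i, j⟩, Set.mem_iUnion.2 ⟨?_, hj'⟩⟩, rfl⟩
        exact Finset.mem_coe.2
          (Finset.mem_antidiagonal.2 ⟨hi, support_iterate_subset c a f n hj', rfl⟩)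

/-- Termwise derivative of a summable family. -/
noncomputable def derivFamily (c : Γ →+ k) (s : HahnSeries.SummableFamily Γ k ℕ) :
    HahnSeries.SummableFamily Γ k ℕ where
  toFun n := deriv c (s n)
  isPWO_iUnion_support' :=
    s.isPWO_iUnion_support.mono (Set.iUnion_mono fun n => support_deriv_subset c (s n))
  finite_co_support' g :=
    (s.finite_co_support g).subset fun n hn => support_deriv_subset c (s n) hn

theorem hsum_derivFamily (c : Γ →+ k) (s : HahnSeries.SummableFamily Γ k ℕ) :
    (derivFamily c s).hsum = deriv c s.hsum := by
  ext g
  let φ : k →+ k :=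
    { toFun := fun x => x′ + x * c g
      map_zero' := by simp
      map_add' := fun x y => by simp only [map_add]; ring }
  have h := φ.map_finsum (s.finite_co_support g)
  rw [coeff_deriv, HahnSeries.SummableFamily.coeff_hsum, HahnSeries.SummableFamily.coeff_hsum]
  exact h.symm

theorem oneSubOp_neumann (c : Γ →+ k) {a : k⟦Γ⟧} (ha : 0 < a.orderTop) (f : k⟦Γ⟧) :
    oneSubOp c a (neumannFamily c a ha f).hsum = f := by
  set s := neumannFamily c a ha f with hs
  have key : (a • derivFamily c s).embDomain ⟨Nat.succ, Nat.succ_injective⟩ =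
      s - HahnSeries.SummableFamily.ofFinsupp (Finsupp.single 0 f) := by
    apply HahnSeries.SummableFamily.ext
    rintro (_ | n)
    · rw [HahnSeries.SummableFamily.embDomain_of_notMem_range _ _ (by simp)]
      simp [hs, neumannFamily]
    · have h1 : s (n + 1) = a * deriv c (s n) := Function.iterate_succ_apply' _ n f
      have h2 := HahnSeries.SummableFamily.embDomain_image (a • derivFamily c s)
        ⟨Nat.succ, Nat.succ_injective⟩ (a := n)
      have h3 : derivFamily c s n = deriv c (s n) := rfl
      simp only [Function.Embedding.coeFn_mk, Nat.succ_eq_add_one] at h2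
      rw [h2]
      simp [h1, h3, HahnSeries.of_symm_smul_of_eq_mul, -smul_eq_mul]
  change s.hsum - a * deriv c s.hsum = f
  rw [← hsum_derivFamily, ← HahnSeries.SummableFamily.hsum_smul,
    ← HahnSeries.SummableFamily.hsum_embDomain (a • derivFamily c s) ⟨Nat.succ, Nat.succ_injective⟩, key]
  simp

theorem oneSubOp_bijective (c : Γ →+ k) {a : k⟦Γ⟧} (ha : 0 < a.orderTop) :
    Function.Bijective (oneSubOp c a) :=
  ⟨oneSubOp_injective c ha, fun f => ⟨_, oneSubOp_neumann c ha f⟩⟩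

/-- The operator `(I - a∂)⁻¹` on `k((t^Γ))`, for `a ≺ 1`. -/
noncomputable def invOp (c : Γ →+ k) (a : k⟦Γ⟧) (ha : 0 < a.orderTop) : k⟦Γ⟧ ≃+ k⟦Γ⟧ :=
  (AddEquiv.ofBijective (oneSubOp c a) (oneSubOp_bijective c ha)).symm

/-- `(I - a∂)⁻¹(f)` is the unique `y` with `y - a ∂(y) = f`. -/
theorem invOp_eq_iff (c : Γ →+ k) (a : k⟦Γ⟧) (ha : 0 < a.orderTop) (f y : k⟦Γ⟧) :
    invOp c a ha f = y ↔ y - a * deriv c y = f := by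
  rw [invOp, AddEquiv.symm_apply_eq, eq_comm]
  rfl

/-- `(I - a∂)⁻¹ = ∑ₙ (a∂)ⁿ`. -/
theorem invOp_eq_hsum (c : Γ →+ k) (a : k⟦Γ⟧) (ha : 0 < a.orderTop) (f : k⟦Γ⟧) :
    invOp c a ha f = (neumannFamily c a ha f).hsum :=
  (invOp_eq_iff c a ha f _).2 (oneSubOp_neumann c ha f)

/-- A set of Hahn series is truncation closed if it contains, with each `f = ∑ f_γ t^γ` in it
and each `γ₀`, the truncation `∑_{γ < γ₀} f_γ t^γ`. -/
def TruncationClosed (S : Set k⟦Γ⟧) : Prop :=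
  ∀ f ∈ S, ∀ γ : Γ, HahnSeries.truncLT γ f ∈ S

/-- The subfield `F` is a differential subfield of `k((t^Γ))`. -/
def IsDifferentialSubfield (c : Γ →+ k) (F : Subfield k⟦Γ⟧) : Prop :=
  ∀ f ∈ F, deriv c f ∈ F

/-- The subfield `F` is closed under `(I - a∂)⁻¹` for all `a ≺ 1` in `F`. -/
def IsInvOpClosed (c : Γ →+ k) (F : Subfield k⟦Γ⟧) : Prop :=
  ∀ a ∈ F, ∀ ha : 0 < a.orderTop, ∀ f ∈ F, invOp c a ha f ∈ F

/-- The smallest differential subfield of `k((t^Γ))` that contains `E` and is closed under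
`(I - a∂)⁻¹` for all `a ≺ 1` in it. -/
noncomputable def hatClosure (c : Γ →+ k) (E : Subfield k⟦Γ⟧) : Subfield k⟦Γ⟧ :=
  sInf {F | E ≤ F ∧ IsDifferentialSubfield c F ∧ IsInvOpClosed c F}

theorem isLeast_hatClosure (c : Γ →+ k) (E : Subfield k⟦Γ⟧) :
    IsLeast {F | E ≤ F ∧ IsDifferentialSubfield c F ∧ IsInvOpClosed c F} (hatClosure c E) := by
  refine ⟨⟨le_sInf fun F hF => hF.1, fun f hf => ?_, fun a haF ha f hf => ?_⟩,
    fun F hF => sInf_le hF⟩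
  · exact Subfield.mem_sInf.2 fun F hF => hF.2.1 f (Subfield.mem_sInf.1 hf F hF)
  · exact Subfield.mem_sInf.2 fun F hF =>
      hF.2.2 a (Subfield.mem_sInf.1 haF F hF) ha f (Subfield.mem_sInf.1 hf F hF)

end HahnDiff

namespace HahnDiff

set_option linter.unusedSectionVars false

open HahnSeries

/-! ### Truncations of products and inverses -/

section Truncation

variable {k Γ : Type*} [Field k] [AddCommGroup Γ] [LinearOrder Γ] [IsOrderedAddMonoid Γ]

/-! For a subfield `K`, the elements of `K` with all truncations in `K` form a set `truncSubfield
K`. For `K = hatClosure c E` this set contains `E`; once it is a differential subfield closed under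
`(I - a∂)⁻¹`, minimality makes it all of `K`.

The engine is `exists_truncLT_mul_eq`: a truncation of `a * z` is affine in one truncation of `z`,
with coefficient `b ∈ K` a segment of `a` and constant term built from strictly shorter truncations
of `z`. By well-founded induction on the truncations of `z`, that constant lies in `K`. If `z`
solves `x * z = 1` or `z - a * ∂z = f`, truncating the equation gives one of the same shape for the
truncation of `z`, with `b` in place of `x` or `a`, and it is solvable in `K`. -/

theorem truncLT_eq_self {γ : Γ} {x : HahnSeries Γ k} (h : ∀ i ∈ x.support, i < γ) :
    truncLT γ x = x := by
  ext i
  rw [HahnSeries.coeff_truncLT]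
  split_ifs with hi
  · rfl
  · by_contra h0
    exact hi (h i (Ne.symm h0))

theorem truncLT_eq_zero {γ : Γ} {x : HahnSeries Γ k} (h : ∀ i ∈ x.support, γ ≤ i) :
    truncLT γ x = 0 := by
  ext i
  rw [HahnSeries.coeff_truncLT]
  split_ifs with hi
  · by_contra h0
    exact absurd hi (h i h0).not_gt
  · rfl

theorem truncLT_neg (γ : Γ) (x : HahnSeries Γ k) : truncLT γ (-x) = -truncLT γ x := by
  ext i
  simp only [HahnSeries.coeff_truncLT, coeff_neg]
  split_ifs <;> simp

/-- If the condition `i + j < γ` on supports depends on `j` alone, truncating a product amounts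
to truncating the second factor. -/
theorem truncLT_mul_eq {γ w : Γ} {b z : HahnSeries Γ k}
    (h : ∀ i ∈ b.support, ∀ j ∈ z.support, i + j < γ ↔ j < w) :
    truncLT γ (b * z) = b * truncLT w z := by
  have hz : z = truncLT w z + (z - truncLT w z) := by ring
  have h1 : truncLT γ (b * truncLT w z) = b * truncLT w z := by
    refine truncLT_eq_self fun g hg => ?_
    obtain ⟨i, hi, j, hj, rfl⟩ := support_mul_subset hg
    rw [mem_support, HahnSeries.coeff_truncLT] at hj
    have hjw : j < w := by
      by_contra h0
      simp [h0] at hj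
    rw [if_pos hjw] at hj
    exact (h i hi j hj).2 hjw
  have h2 : truncLT γ (b * (z - truncLT w z)) = 0 := by
    refine truncLT_eq_zero fun g hg => ?_
    obtain ⟨i, hi, j, hj, rfl⟩ := support_mul_subset hg
    rw [mem_support, coeff_sub, HahnSeries.coeff_truncLT] at hj
    have hjw : ¬ j < w := by
      intro h0
      simp [h0] at hj
    rw [if_neg hjw, sub_zero] at hj
    exact not_lt.1 fun h0 => hjw ((h i hi j hj).1 h0)
  conv_lhs => rw [hz, mul_add, truncLT_add, h1, h2, add_zero]

/-- `β < γ` and the truncations of `z` at `β` and `γ` differ. -/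
def TruncRel (z : HahnSeries Γ k) (β γ : Γ) : Prop := ∃ j ∈ z.support, β ≤ j ∧ j < γ

theorem TruncRel.trans {z : HahnSeries Γ k} {α β γ : Γ} (h₁ : TruncRel z α β)
    (h₂ : TruncRel z β γ) : TruncRel z α γ := by
  obtain ⟨j, hj, h, h'⟩ := h₁
  obtain ⟨l, -, hl, hl'⟩ := h₂
  exact ⟨j, hj, h, h'.trans (hl.trans_lt hl')⟩

/-- A descending chain is interleaved with a strictly descending sequence in the well-ordered
support of `z`. -/
theorem wellFounded_truncRel (z : HahnSeries Γ k) : WellFounded (TruncRel z) := by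
  have key : ∀ j ∈ z.support, ∀ w ≤ j, Acc (TruncRel z) w := by
    intro j hj
    refine z.isWF_support.induction hj
      (P := fun j => ∀ w ≤ j, Acc (TruncRel z) w) fun j _ ih w hw => ⟨_, ?_⟩
    rintro v ⟨i, hi, hvi, hiw⟩
    exact ih i hi (hiw.trans_le hw) v hvi
  refine ⟨fun w => ⟨_, ?_⟩⟩
  rintro v ⟨i, hi, hvi, -⟩
  exact key i hi v hvi

theorem mem_support_sub_truncLT {α i : Γ} {a : HahnSeries Γ k} :
    i ∈ (a - truncLT α a).support ↔ i ∈ a.support ∧ α ≤ i := by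
  rw [mem_support, coeff_sub, HahnSeries.coeff_truncLT, mem_support]
  split_ifs with h
  · simp [h]
  · simp [not_lt.1 h]

theorem mem_support_truncLT_sub_truncLT {α β i : Γ} (hαβ : α ≤ β) {a : HahnSeries Γ k} :
    i ∈ (truncLT β a - truncLT α a).support ↔ i ∈ a.support ∧ α ≤ i ∧ i < β := by
  rw [mem_support, coeff_sub, HahnSeries.coeff_truncLT, HahnSeries.coeff_truncLT, mem_support]
  by_cases h : i < α
  · simp [h, h.trans_le hαβ]
  · by_cases h' : i < β <;> simp [h, h', not_lt.1 h]

/-- Up to terms involving strictly shorter truncations of `z`, the truncation of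
`(∑_{i ≥ α} a_i t^i) z` at `γ` is `b` times the truncation of `z` at `γ - α`, where `b` is the
restriction of `a` to an interval starting at `α`. -/
theorem exists_truncLT_mul_eq (K : Subfield (HahnSeries Γ k)) {a z : HahnSeries Γ k} {γ : Γ}
    (ha : a ∈ K) (hta : ∀ β, truncLT β a ∈ K) (α : Γ)
    (hz : ∀ β, TruncRel z β (γ - α) → truncLT β z ∈ K) :
    ∃ b ∈ K, ∃ r ∈ K, b.support ⊆ a.support ∧ b.coeff α = a.coeff α ∧
      truncLT γ ((a - truncLT α a) * z) = b * truncLT (γ - α) z + r := by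
  induction hw : γ - α using (wellFounded_truncRel z).induction generalizing α with
  | _ w ih =>
  subst hw
  -- Does some exponent `i` of `a` see a strictly shorter truncation of `z` than `α` does? Such an
  -- `i` exceeds `α`; the least one, `α'`, is where `a` is cut.
  by_cases hS : ∃ i ∈ a.support, TruncRel z (γ - i) (γ - α)
  · have hwf := a.isWF_support.mono
      (Set.sep_subset a.support fun i => TruncRel z (γ - i) (γ - α))
    obtain ⟨α', ⟨hα', hr⟩, hmin⟩ : ∃ α' ∈ {i ∈ a.support | TruncRel z (γ - i) (γ - α)},
        ∀ i ∈ {i ∈ a.support | TruncRel z (γ - i) (γ - α)}, ¬ i < α' :=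
      ⟨hwf.min hS, hwf.min_mem hS, fun i hi => hwf.not_lt_min hS hi⟩
    obtain ⟨b', hb', r', hr', -, -, h⟩ := ih _ hr α' (fun β hβ => hz β (hβ.trans hr)) rfl
    have hαα' : α < α' := by
      obtain ⟨j, -, h1, h2⟩ := hr
      exact (sub_lt_sub_iff_left γ).1 (h1.trans_lt h2)
    -- The tail of `a` from `α'` on involves only truncations of `z` shorter than the one at `γ -
    -- α`, so it is absorbed into `r`.
    refine ⟨truncLT α' a - truncLT α a, sub_mem (hta _) (hta _),
      b' * truncLT (γ - α') z + r', add_mem (mul_mem hb' (hz _ hr)) hr', ?_, ?_, ?_⟩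
    · exact fun i hi => ((mem_support_truncLT_sub_truncLT hαα'.le).1 hi).1
    · simp [hαα']
    · have hsplit : (a - truncLT α a) * z =
          (truncLT α' a - truncLT α a) * z + (a - truncLT α' a) * z := by ring
      rw [hsplit, truncLT_add, h, truncLT_mul_eq (w := γ - α)]
      intro i hi j hj
      obtain ⟨hia, hαi, hiα'⟩ := (mem_support_truncLT_sub_truncLT hαα'.le).1 hi
      rw [← lt_sub_iff_add_lt']
      refine ⟨fun h' => h'.trans_le (sub_le_sub_left hαi γ), fun h' => ?_⟩
      by_contra h0
      -- Otherwise `i < α'` would already see a shorter truncation, against the minimality of `α'`.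
      exact hmin i ⟨hia, j, hj, not_lt.1 h0, h'⟩ hiα'
  · refine ⟨a - truncLT α a, sub_mem ha (hta _), 0, zero_mem _,
      fun i hi => (mem_support_sub_truncLT.1 hi).1, by simp, ?_⟩
    rw [add_zero, truncLT_mul_eq]
    intro i hi j hj
    obtain ⟨hia, hαi⟩ := mem_support_sub_truncLT.1 hi
    rw [← lt_sub_iff_add_lt']
    refine ⟨fun h' => h'.trans_le (sub_le_sub_left hαi γ), fun h' => ?_⟩
    by_contra h0
    exact hS ⟨i, hia, j, hj, not_lt.1 h0, h'⟩

theorem exists_truncLT_mul_eq_of_forall_le (K : Subfield (HahnSeries Γ k))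
    {a z : HahnSeries Γ k} {γ : Γ}
    (ha : a ∈ K) (hta : ∀ β, truncLT β a ∈ K) {α : Γ} (hα : ∀ i ∈ a.support, α ≤ i)
    (hz : ∀ β, TruncRel z β (γ - α) → truncLT β z ∈ K) :
    ∃ b ∈ K, ∃ r ∈ K, b.support ⊆ a.support ∧ b.coeff α = a.coeff α ∧
      truncLT γ (a * z) = b * truncLT (γ - α) z + r := by
  have h := exists_truncLT_mul_eq K ha hta α hz
  rwa [truncLT_eq_zero hα, sub_zero] at h

theorem order_le_of_mem_support {a : HahnSeries Γ k} {i : Γ} (hi : i ∈ a.support) :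
    a.order ≤ i := order_le_of_coeff_ne_zero hi

/-- The elements of a subfield `K` all of whose truncations lie in `K` form a subfield. -/
noncomputable def truncSubfield (K : Subfield (HahnSeries Γ k)) :
    Subfield (HahnSeries Γ k) where
  carrier := {f | f ∈ K ∧ ∀ γ, truncLT γ f ∈ K}
  zero_mem' := ⟨zero_mem _, fun γ => by
    rw [truncLT_eq_zero (by simp)]
    exact zero_mem K⟩
  one_mem' := ⟨one_mem _, fun γ => by
    by_cases h : 0 < γ
    · rw [truncLT_eq_self (by simpa using h)]
      exact one_mem K
    · rw [truncLT_eq_zero (by simpa using h)]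
      exact zero_mem K⟩
  add_mem' := fun {x y} hx hy => ⟨add_mem hx.1 hy.1, fun γ => by
    rw [truncLT_add]
    exact add_mem (hx.2 γ) (hy.2 γ)⟩
  neg_mem' := fun {x} hx => ⟨neg_mem hx.1, fun γ => by
    rw [truncLT_neg]
    exact neg_mem (hx.2 γ)⟩
  mul_mem' := fun {x y} hx hy => ⟨mul_mem hx.1 hy.1, fun γ => by
    obtain ⟨b, hb, r, hr, -, -, h⟩ := exists_truncLT_mul_eq_of_forall_le K (γ := γ) hx.1 hx.2
      (fun _ => order_le_of_mem_support) (fun β _ => hy.2 β)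
    rw [h]
    exact add_mem (mul_mem hb (hy.2 _)) hr⟩
  inv_mem' := fun x hx => ⟨inv_mem hx.1, fun γ => by
    rcases eq_or_ne x 0 with rfl | hx0
    · rw [inv_zero, truncLT_eq_zero (by simp)]
      exact zero_mem K
    induction γ using (wellFounded_truncRel x⁻¹).induction with
    | _ γ ih =>
    -- The shift by `x.order` makes the truncation of `x⁻¹` at exactly `γ` the unknown. As `b` keeps
    -- the leading coefficient of `x`, it can be divided by.
    obtain ⟨b, hb, r, hr, -, hbc, h⟩ := exists_truncLT_mul_eq_of_forall_le K (z := x⁻¹)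
      (γ := γ + x.order) hx.1 hx.2 (fun _ => order_le_of_mem_support)
      (fun β hβ => ih β (by rwa [add_sub_cancel_right] at hβ))
    have hb0 : b ≠ 0 := by
      rintro rfl
      exact hx0 (coeff_order_eq_zero.1 hbc.symm)
    rw [mul_inv_cancel₀ hx0, add_sub_cancel_right] at h
    have h1 : truncLT (γ + x.order) (1 : HahnSeries Γ k) ∈ K := by
      by_cases h : 0 < γ + x.order
      · rw [truncLT_eq_self (by simpa using h)]
        exact one_mem K
      · rw [truncLT_eq_zero (by simpa using h)]
        exact zero_mem K
    have h2 : truncLT γ x⁻¹ = (truncLT (γ + x.order) 1 - r) / b := by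
      rw [h]
      field_simp
      ring
    rw [h2]
    exact div_mem (sub_mem h1 hr) hb⟩

end Truncation

/-! ### Compatibility with `∂` and `(I - a∂)⁻¹` -/

variable {k Γ : Type*} [Field k] [Differential k]
  [AddCommGroup Γ] [LinearOrder Γ] [IsOrderedAddMonoid Γ]

theorem truncLT_deriv (c : Γ →+ k) (γ : Γ) (f : HahnSeries Γ k) :
    truncLT γ (deriv c f) = deriv c (truncLT γ f) := by
  ext i
  simp only [HahnSeries.coeff_truncLT, coeff_deriv]
  split_ifs <;> simp

theorem IsDifferentialSubfield.truncSubfield {c : Γ →+ k} {K : Subfield (HahnSeries Γ k)}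
    (hK : IsDifferentialSubfield c K) : IsDifferentialSubfield c (truncSubfield K) :=
  fun f hf => ⟨hK f hf.1, fun γ => by
    rw [truncLT_deriv]
    exact hK _ (hf.2 γ)⟩

/-- Since truncation commutes with `∂`, truncating `y = f + a * ∂y` at `γ` shows that the truncation
of `y` is `(I - b∂)⁻¹` of an element of `K`, where `b ≺ 1` because its support lies in that of `a`.
-/
theorem IsInvOpClosed.truncSubfield {c : Γ →+ k} {K : Subfield (HahnSeries Γ k)}
    (hK : IsDifferentialSubfield c K) (hK' : IsInvOpClosed c K) :
    IsInvOpClosed c (truncSubfield K) := by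
  intro a ha ha0 f hf
  refine ⟨hK' a ha.1 ha0 f hf.1, fun γ => ?_⟩
  obtain ⟨y, hy⟩ : ∃ y, invOp c a ha0 f = y := ⟨_, rfl⟩
  rw [hy]
  have hyf := (invOp_eq_iff c a ha0 f y).1 hy
  induction γ using (wellFounded_truncRel y).induction with
  | _ γ ih =>
  have hpos : ∀ i ∈ a.support, 0 < i := fun i hi =>
    WithTop.coe_lt_coe.1 (ha0.trans_le (orderTop_le_of_coeff_ne_zero hi))
  -- Taking `α = 0`, a lower bound for the support of `a`, keeps the unknown truncation at `γ`
  -- itself. The induction hypothesis applies because `∂y` has support inside that of `y`.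
  obtain ⟨b, hb, r, hr, hba, -, h⟩ := exists_truncLT_mul_eq_of_forall_le K (z := deriv c y)
    (γ := γ) ha.1 ha.2 (fun i hi => (hpos i hi).le) (fun β hβ => by
      obtain ⟨j, hj, h1, h2⟩ := hβ
      rw [sub_zero] at h2
      rw [truncLT_deriv]
      exact hK _ (ih β ⟨j, support_deriv_subset c y hj, h1, h2⟩))
  have hb0 : 0 < b.orderTop := by
    rcases eq_or_ne b 0 with rfl | hb0
    · simp
    · exact (zero_lt_orderTop_iff hb0).2
        (hpos _ (hba (coeff_order_eq_zero.not.2 hb0)))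
  rw [sub_zero, truncLT_deriv] at h
  have h1 : truncLT γ y = truncLT γ f + truncLT γ (a * deriv c y) := by
    rw [← truncLT_add, ← hyf, sub_add_cancel]
  have h2 : invOp c b hb0 (truncLT γ f + r) = truncLT γ y := by
    rw [invOp_eq_iff, sub_eq_iff_eq_add]
    conv_lhs => rw [h1, h]
    ring
  rw [← h2]
  exact hK' b hb hb0 _ (add_mem (hf.2 γ) hr)

end HahnDiff

theorem mainTheorem3 {k Γ : Type*} [Field k] [Differential k]
    [AddCommGroup Γ] [LinearOrder Γ] [IsOrderedAddMonoid Γ]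
    (c : Γ →+ k) (E : Subfield (HahnSeries Γ k))
    (hEd : HahnDiff.IsDifferentialSubfield c E)
    (hEt : HahnDiff.TruncationClosed (E : Set (HahnSeries Γ k))) :
    HahnDiff.TruncationClosed (HahnDiff.hatClosure c E : Set (HahnSeries Γ k)) := by
  obtain ⟨⟨hle, hd, hi⟩, hmin⟩ := HahnDiff.isLeast_hatClosure c E
  have h : HahnDiff.hatClosure c E ≤ HahnDiff.truncSubfield (HahnDiff.hatClosure c E) :=
    hmin ⟨fun f hf => ⟨hle hf, fun γ => hle (hEt f hf γ)⟩, hd.truncSubfield,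
      HahnDiff.IsInvOpClosed.truncSubfield hd hi⟩
  exact fun f hf γ => (h hf).2 γ
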